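/- Theorem 4.2. Let $\Omega\subset\mathbb C$ be a (nonempty) connected open set, let $n$ be a positive integer, and let $\mathcal H$ be a complex Hilbert space. A bounded operator $T$ on $\mathcal H$ belongs to $\mathcal B_n(\Omega)$ if $\Omega\subset\sigma(T)$, $\operatorname{ran}(T-\lambda)=\mathcal H$ and $\dim\ker(T-\lambda)=n$ for every $\lambda\in\Omega$, and the closed linear span $\bigvee_{\lambda\in\Omega}\ker(T-\lambda)$ is $\mathcal H$. Operators $T$ on $\mathcal H$ and $S$ on $\mathcal K$ are unitarily equivalent, $T\sim_u S$, if $UT=SU$ for some unitary $U:\mathcal H\to\mathcal K$. An operator is irreducible if the only self-adjoint idempotent operators commuting with it are $0$ and $I$. An (IR) decomposition of $T\in\mathcal B_n(\Omega)$ is a decomposition, up to a unitary identification of the underlying spaces, $$T=\bigoplus_{i=1}^{t}T_i^{(m_i)},$$ into an orthogonal direct sum of $m_i\ge 1$ copies of $T_i$ $(1\le i\le t)$, where each $T_i$ is an irreducible operator on a Hilbert space $\mathcal H_i$, $T_i\in\mathcal B_{n_i}(\Omega)$ for some $n_i\ge1$, $\sum_{i=1}^t m_in_i=n$, and $T_i\not\sim_u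 T_j$ for $i\ne j$. Every $T\in\mathcal B_n(\Omega)$ has an (IR) decomposition, and it is unique up to unitary equivalence in the following sense: if $T=\bigoplus_{i=1}^{t}T_i^{(m_i)}$ is an (IR) decomposition of $T$, and $\widetilde T=\bigoplus_{i=1}^{s}\widetilde T_i^{(l_i)}$ is an (IR) decomposition of an operator $\widetilde T\sim_u T$, then $t=s$ and there is a permutation $\pi$ of $\{1,\dots,t\}$ such that $T_i\sim_u\widetilde T_{\pi(i)}$ and $m_i=l_{\pi(i)}$ for all $1\le i\le t$. -/

import Mathlib

universe u v u' v'

/-- `T` (on `H`) and `S` (on `K`) are unitarily equivalent: `U T = S U` for some unitary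
`U : H → K`. -/
def UnitarilyEquivalent {H : Type u} [NormedAddCommGroup H] [InnerProductSpace ℂ H]
    {K : Type v} [NormedAddCommGroup K] [InnerProductSpace ℂ K]
    (T : H →L[ℂ] H) (S : K →L[ℂ] K) : Prop :=
  ∃ U : H ≃ₗᵢ[ℂ] K, ∀ x, U (T x) = S (U x)

/-- The Cowen–Douglas class `B_n(Ω)`, `n` a positive integer. -/
structure IsCowenDouglas {H : Type u} [NormedAddCommGroup H] [InnerProductSpace ℂ H]
    (Ω : Set ℂ) (n : ℕ) (T : H →L[ℂ] H) : Prop where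
  pos : 0 < n
  subset_spectrum : Ω ⊆ spectrum ℂ T
  range_eq_top : ∀ z ∈ Ω, LinearMap.range ((T - z • 1 : H →L[ℂ] H) : H →ₗ[ℂ] H) = ⊤
  span_ker : (⨆ z ∈ Ω,
    LinearMap.ker ((T - z • 1 : H →L[ℂ] H) : H →ₗ[ℂ] H)).topologicalClosure = ⊤
  finrank_ker : ∀ z ∈ Ω,
    Module.finrank ℂ (LinearMap.ker ((T - z • 1 : H →L[ℂ] H) : H →ₗ[ℂ] H)) = n

/-- `T` is irreducible: the only self-adjoint idempotents commuting with `T` are `0` and `1`. -/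
def IsIrreducibleOperator {H : Type u} [NormedAddCommGroup H] [InnerProductSpace ℂ H]
    [CompleteSpace H] (T : H →L[ℂ] H) : Prop :=
  ∀ P : H →L[ℂ] H, IsSelfAdjoint P → IsIdempotentElem P → P * T = T * P → P = 0 ∨ P = 1

/-- The orthogonal direct sum `⨁ i, T i` of finitely many operators, acting coordinatewise on the
Hilbert direct sum of the spaces. -/
noncomputable def directSumOperator {ι : Type*} [Fintype ι] {E : ι → Type v}
    [∀ i, NormedAddCommGroup (E i)] [∀ i, InnerProductSpace ℂ (E i)]
    (T : ∀ i, E i →L[ℂ] E i) : PiLp 2 E →L[ℂ] PiLp 2 E :=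
  ((PiLp.continuousLinearEquiv 2 ℂ E).symm : (∀ i, E i) →L[ℂ] PiLp 2 E) ∘L
    ContinuousLinearMap.piMap T ∘L (PiLp.continuousLinearEquiv 2 ℂ E : PiLp 2 E →L[ℂ] ∀ i, E i)

theorem directSumOperator_apply {ι : Type*} [Fintype ι] {E : ι → Type v}
    [∀ i, NormedAddCommGroup (E i)] [∀ i, InnerProductSpace ℂ (E i)]
    (T : ∀ i, E i →L[ℂ] E i) (x : PiLp 2 E) (i : ι) :
    directSumOperator T x i = T i (x i) := rfl

/-- An (IR) decomposition `T = ⨁_{i < t} T_i^{(m_i)}` of `T ∈ B_n(Ω)`, where `T_i ∈ B_{n_i}(Ω)` acts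
on the Hilbert space `space i`, every `T_i` is irreducible, `∑ m_i n_i = n`, and `T_i`, `T_j` are not
unitarily equivalent for `i ≠ j`. The equality sign is the identification of the space of `T` with
the Hilbert direct sum of `m_i` copies of each `space i` by a unitary operator. -/
structure IRDecomposition {H : Type u} [NormedAddCommGroup H] [InnerProductSpace ℂ H]
    (Ω : Set ℂ) (n : ℕ) (T : H →L[ℂ] H) where
  /-- The number `t` of distinct summands. -/
  t : ℕ
  /-- The Hilbert spaces on which the summands act. -/
  space : Fin t → Type v
  [normedAddCommGroup : ∀ i, NormedAddCommGroup (space i)]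
  [innerProductSpace : ∀ i, InnerProductSpace ℂ (space i)]
  [completeSpace : ∀ i, CompleteSpace (space i)]
  /-- The distinct summands `T_i`. -/
  summand : ∀ i, space i →L[ℂ] space i
  /-- The multiplicities `m_i`. -/
  mult : Fin t → ℕ
  /-- The ranks `n_i`. -/
  rank : Fin t → ℕ
  mult_pos : ∀ i, 0 < mult i
  cowenDouglas : ∀ i, IsCowenDouglas Ω (rank i) (summand i)
  sum_eq : ∑ i, mult i * rank i = n
  irreducible : ∀ i, IsIrreducibleOperator (summand i)
  not_equiv : ∀ i j, i ≠ j → ¬ UnitarilyEquivalent (summand i) (summand j)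
  eq_directSum : UnitarilyEquivalent T
    (directSumOperator fun p : (Σ i, Fin (mult i)) => summand p.1)

attribute [instance] IRDecomposition.normedAddCommGroup IRDecomposition.innerProductSpace
  IRDecomposition.completeSpace

/-! Existence: on a nonzero reducing subspace `V`, the operator `T` is again Cowen–Douglas.
Surjectivity of `T - z` and density of the eigenvectors survive the projection onto `V`, and the
kernel dimension is locally constant, hence constant on the connected set `Ω`; it is not zero, since
the eigenvectors span `V`. So `dim (V ⊓ ker (T - z₀))` strictly increases along reducing subspaces,
and repeated splitting stops at minimal ones, where `T` is irreducible
(`exists_finset_isMinimalReducing`). Grouping these by unitary equivalence gives the decomposition.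

Uniqueness: a unitary between two decompositions is a matrix of blocks, each of which intertwines
irreducible operators, as does its adjoint. By Schur's lemma
(`IsIrreducibleOperator.unitarilyEquivalent`) a nonzero block forces unitary equivalence. So every
summand has a partner, and eigenvectors from the copies of a summand land in the copies of its
partner. Comparing kernel dimensions at one point bounds one multiplicity by the other (`mult_le`);
symmetry gives equality. -/

/-! ### Schur's lemma for irreducible operators -/

section Schur

variable {E : Type*} [NormedAddCommGroup E] [InnerProductSpace ℂ E] [CompleteSpace E]
  {F : Type*} [NormedAddCommGroup F] [InnerProductSpace ℂ F] [CompleteSpace F]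

/-- For an irreducible operator, a closed subspace that it and its adjoint leave invariant is
trivial. -/
theorem IsIrreducibleOperator.eq_bot_or_eq_top {T : E →L[ℂ] E} (hT : IsIrreducibleOperator T)
    (V : Submodule ℂ E) [V.HasOrthogonalProjection] (h : ∀ x ∈ V, T x ∈ V)
    (h' : ∀ x ∈ Vᗮ, T x ∈ Vᗮ) : V = ⊥ ∨ V = ⊤ := by
  have hcomm : V.starProjection * T = T * V.starProjection := by
    ext x
    change V.starProjection (T x) = T (V.starProjection x)
    have h1 : T x = T (V.starProjection x) + T (x - V.starProjection x) := by
      rw [← map_add]; congr 1; abel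
    rw [h1, map_add, (Submodule.starProjection_eq_self_iff).2 (h _ (V.starProjection_apply_mem x)),
      (Submodule.starProjection_apply_eq_zero_iff V).2 (h' _ (V.sub_starProjection_mem_orthogonal x)),
      add_zero]
  rcases hT _ (isSelfAdjoint_starProjection V) V.isIdempotentElem_starProjection hcomm with h0 | h1
  · left
    rw [eq_bot_iff]
    intro x hx
    have := Submodule.starProjection_eq_self_iff.2 hx
    rw [h0] at this
    simpa using this.symm
  · right
    rw [eq_top_iff]
    intro x _
    rw [← Submodule.starProjection_eq_self_iff, h1]
    rfl

/-- A self-adjoint operator commuting with an irreducible operator is scalar. -/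
theorem IsIrreducibleOperator.exists_eq_smul {T : E →L[ℂ] E} (hT : IsIrreducibleOperator T)
    {S : E →L[ℂ] E} (hS : IsSelfAdjoint S) (hST : Commute S T) : ∃ c : ℝ, S = c • 1 := by
  by_cases hsub : (spectrum ℝ S).Subsingleton
  · rcases hsub.eq_empty_or_singleton with h | ⟨c, h⟩
    -- Empty spectrum occurs only on the zero space, where any scalar serves.
    · refine ⟨0, ?_⟩
      rw [zero_smul, ← cfc_id' ℝ S, cfc_congr (g := fun _ => 0) (by simp [Set.EqOn, h])]
      simp
    · refine ⟨c, ?_⟩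
      conv_lhs => rw [← cfc_id' ℝ S, cfc_congr (g := fun _ => c) (by simp [Set.EqOn, h])]
      rw [cfc_const c S, Algebra.algebraMap_eq_smul_one]
  exfalso
  rw [Set.not_subsingleton_iff] at hsub
  obtain ⟨a, ha, b, hb, hab⟩ := hsub.exists_lt
  set m := (a + b) / 2 with hm
  -- With `m` strictly between two spectral points, the negative and positive parts of `x - m` have
  -- product zero, yet neither vanishes on the spectrum. Hence the kernel of `g(S)` contains the
  -- nonzero range of `f(S)` but is not everything: a nontrivial reducing subspace.
  let f : ℝ → ℝ := fun x => max (m - x) 0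
  let g : ℝ → ℝ := fun x => max (x - m) 0
  have hf : Continuous f := by fun_prop
  have hg : Continuous g := by fun_prop
  have ne_zero : ∀ k : ℝ → ℝ, Continuous k → ∀ x ∈ spectrum ℝ S, k x ≠ 0 → cfc k S ≠ 0 := by
    intro k hk x hx hkx h0
    have h1 : k x ∈ spectrum ℝ (cfc k S) := by
      rw [cfc_map_spectrum k S (hf := hk.continuousOn) (ha := hS)]
      exact ⟨x, hx, rfl⟩
    have h2 : Nontrivial (E →L[ℂ] E) := by
      by_contra hn
      rw [not_nontrivial_iff_subsingleton] at hn
      simp at h1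
    rw [h0, spectrum.zero_eq] at h1
    exact hkx h1
  have hf0 : cfc f S ≠ 0 := ne_zero f hf a ha (by
    have : 0 < m - a := by rw [hm]; linarith
    simp only [f]; rw [max_eq_left this.le]; exact this.ne')
  have hg0 : cfc g S ≠ 0 := ne_zero g hg b hb (by
    have : 0 < b - m := by rw [hm]; linarith
    simp only [g]; rw [max_eq_left this.le]; exact this.ne')
  have hgf : cfc g S * cfc f S = 0 := by
    rw [← cfc_mul g f S hg.continuousOn hf.continuousOn]
    have : (fun x => g x * f x) = fun _ => 0 := by
      funext x
      simp only [f, g]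
      rcases le_total x m with h | h
      · rw [max_eq_right (by linarith : x - m ≤ 0), zero_mul]
      · rw [max_eq_right (by linarith : m - x ≤ 0), mul_zero]
    rw [this]; simp
  have hgT : Commute (cfc g S) T := Commute.cfc_real hST g
  have hgs : IsSelfAdjoint (cfc g S) := cfc_predicate g S
  set G := cfc g S with hG
  have hGsymm : ∀ x y, inner ℂ (G x) y = inner ℂ x (G y) := hgs.isSymmetric
  let V := LinearMap.ker (G : E →ₗ[ℂ] E)
  have hVc : IsClosed (V : Set E) := G.isClosed_ker
  have : CompleteSpace V := hVc.completeSpace_coe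
  have hmem : ∀ x, x ∈ V ↔ G x = 0 := fun x => Iff.rfl
  have hTV : ∀ x ∈ V, T x ∈ V := by
    intro x hx
    rw [hmem] at hx ⊢
    have : (G * T) x = (T * G) x := by rw [hgT.eq]
    simpa [hx] using this
  have hTVp : ∀ x ∈ Vᗮ, T x ∈ Vᗮ := by
    -- Since `G` is self-adjoint, the complement of its kernel is the closure of its range, which
    -- `T` preserves because it commutes with `G`.
    have hrange : Vᗮ = (LinearMap.range (G : E →ₗ[ℂ] E)).topologicalClosure := by
      rw [← Submodule.orthogonal_orthogonal_eq_closure, ContinuousLinearMap.orthogonal_range]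
      rw [hgs.adjoint_eq]
    rw [hrange]
    intro x hx
    refine map_mem_closure T.continuous hx ?_
    rintro _ ⟨y, rfl⟩
    refine ⟨T y, ?_⟩
    change (G * T) y = (T * G) y
    rw [hgT.eq]
  rcases hT.eq_bot_or_eq_top V hTV hTVp with h | h
  · apply hf0
    ext x
    have : cfc f S x ∈ V := by
      rw [hmem]
      change (G * cfc f S) x = 0
      rw [hgf]; rfl
    rw [h] at this
    simpa using this
  · apply hg0
    ext x
    have : x ∈ V := h ▸ Submodule.mem_top
    exact this

/-- **Schur's lemma** for irreducible operators. -/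
theorem IsIrreducibleOperator.unitarilyEquivalent {A : E →L[ℂ] E} {B : F →L[ℂ] F}
    (hA : IsIrreducibleOperator A) (hB : IsIrreducibleOperator B) {X : E →L[ℂ] F}
    (hX : ∀ x, X (A x) = B (X x))
    (hX' : ∀ y, X.adjoint (B y) = A (X.adjoint y)) (h0 : X ≠ 0) : UnitarilyEquivalent A B := by
  obtain ⟨c, hc⟩ := hA.exists_eq_smul (S := X.adjoint ∘L X)
    (ContinuousLinearMap.isPositive_adjoint_comp_self X).isSelfAdjoint (by
      ext x; simp [hX, hX'])
  obtain ⟨d, hd⟩ := hB.exists_eq_smul (S := X ∘L X.adjoint) 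
    (ContinuousLinearMap.isPositive_self_comp_adjoint X).isSelfAdjoint (by
      ext x; simp [hX, hX'])
  have hc' : ∀ x, X.adjoint (X x) = c • x := fun x => congrArg (fun S : E →L[ℂ] E => S x) hc
  have hd' : ∀ x, X (X.adjoint x) = d • x := fun x => congrArg (fun S : F →L[ℂ] F => S x) hd
  have hnorm : ∀ x, ‖X x‖ ^ 2 = c * ‖x‖ ^ 2 := by
    intro x
    have h1 : inner ℂ (X.adjoint (X x)) x = inner ℂ (X x) (X x) := X.adjoint_inner_left x (X x)
    rw [hc', inner_smul_left_eq_smul, inner_self_eq_norm_sq_to_K, inner_self_eq_norm_sq_to_K] at h1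
    have h2 : ((c * ‖x‖ ^ 2 : ℝ) : ℂ) = ((‖X x‖ ^ 2 : ℝ) : ℂ) := by
      push_cast
      simpa using h1
    exact_mod_cast h2.symm
  obtain ⟨x₀, hx₀⟩ : ∃ x, X x ≠ 0 := by
    by_contra! h
    exact h0 (ContinuousLinearMap.ext h)
  have hcpos : 0 < c := by
    have h1 : 0 < ‖X x₀‖ ^ 2 := by positivity
    rw [hnorm] at h1
    exact pos_of_mul_pos_left h1 (by positivity)
  -- Both scalars are read off from `X X* X x₀`.
  have hcd : c = d := by
    have h1 : X (X.adjoint (X x₀)) = c • X x₀ := by rw [hc', ContinuousLinearMap.map_smul_of_tower]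
    rw [hd'] at h1
    exact (smul_left_injective ℝ hx₀ h1).symm
  have hs : 0 < √c := Real.sqrt_pos.2 hcpos
  -- `X* X = c` makes `X / √c` isometric, and `X X* = c` makes it onto.
  let U : E →ₗᵢ[ℂ] F := ⟨(((√c)⁻¹ : ℝ) • X : E →L[ℂ] F).toLinearMap, by
    intro x
    change ‖((√c)⁻¹ : ℝ) • X x‖ = ‖x‖
    have h1 : ‖X x‖ = √c * ‖x‖ := by
      rw [← Real.sqrt_sq (norm_nonneg (X x)), hnorm, Real.sqrt_mul hcpos.le,
        Real.sqrt_sq (norm_nonneg x)]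
    rw [norm_smul, h1, Real.norm_of_nonneg (by positivity)]
    field_simp⟩
  have hU : ∀ x, U x = (√c)⁻¹ • X x := fun x => rfl
  have hsurj : Function.Surjective U := by
    intro y
    refine ⟨(√c)⁻¹ • X.adjoint y, ?_⟩
    rw [hU, ContinuousLinearMap.map_smul_of_tower, hd', ← hcd, smul_smul, smul_smul]
    have : (√c)⁻¹ * ((√c)⁻¹ * c) = 1 := by
      nth_rw 3 [← Real.mul_self_sqrt hcpos.le]
      field_simp
    rw [mul_assoc, this, one_smul]
  refine ⟨LinearIsometryEquiv.ofSurjective U hsurj, fun x => ?_⟩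
  change U (A x) = B (U x)
  rw [hU, hU, hX, ContinuousLinearMap.map_smul_of_tower]

end Schur

/-! ### Constancy of the kernel dimension -/

section KerDim

variable {E : Type*} [NormedAddCommGroup E] [InnerProductSpace ℂ E] [CompleteSpace E]

theorem mem_ker_sub_smul {E : Type*} [NormedAddCommGroup E] [InnerProductSpace ℂ E]
    {T : E →L[ℂ] E} {z : ℂ} {x : E} :
    x ∈ LinearMap.ker ((T - z • 1 : E →L[ℂ] E) : E →ₗ[ℂ] E) ↔ T x = z • x := by
  simp [sub_eq_zero]

/-- On the orthogonal complement of its kernel `S` is bijective, so the open mapping theorem inverts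
it there. -/
theorem ContinuousLinearMap.hasRightInverse_of_range_eq_top {S : E →L[ℂ] E}
    (h : LinearMap.range (S : E →ₗ[ℂ] E) = ⊤) : ∃ R : E →L[ℂ] E, ∀ x, S (R x) = x := by
  let K := LinearMap.ker (S : E →ₗ[ℂ] E)
  have hK : IsClosed (K : Set E) := S.isClosed_ker
  have : CompleteSpace K := hK.completeSpace_coe
  let S' : Kᗮ →L[ℂ] E := S ∘L Kᗮ.subtypeL
  have hinj : LinearMap.ker (S' : Kᗮ →ₗ[ℂ] E) = ⊥ := by
    rw [LinearMap.ker_eq_bot']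
    intro x hx
    have h1 : (x : E) ∈ K := hx
    have h2 : (x : E) ∈ K ⊓ Kᗮ := ⟨h1, x.2⟩
    rw [K.inf_orthogonal_eq_bot] at h2
    exact Subtype.ext h2
  have hsurj : LinearMap.range (S' : Kᗮ →ₗ[ℂ] E) = ⊤ := by
    rw [eq_top_iff]
    intro y _
    obtain ⟨x, hx⟩ : y ∈ LinearMap.range (S : E →ₗ[ℂ] E) := h ▸ Submodule.mem_top
    refine ⟨⟨x - K.starProjection x, K.sub_starProjection_mem_orthogonal x⟩, ?_⟩
    have h1 : S (K.starProjection x) = 0 := K.starProjection_apply_mem x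
    have h2 : S x = y := hx
    change S (x - K.starProjection x) = y
    rw [map_sub, h1, h2, sub_zero]
  let e := ContinuousLinearEquiv.ofBijective S' hinj hsurj
  exact ⟨Kᗮ.subtypeL ∘L (e.symm : E →L[ℂ] Kᗮ), fun x => e.apply_symm_apply x⟩

/-- The dimension of `ker (S - z)` is constant on a connected set on which `S - z` is onto. -/
theorem finrank_ker_sub_smul_eq {Ω : Set ℂ} (hΩ : IsPreconnected Ω) {S : E →L[ℂ] E}
    (hS : ∀ z ∈ Ω, LinearMap.range ((S - z • 1 : E →L[ℂ] E) : E →ₗ[ℂ] E) = ⊤)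
    {z w : ℂ} (hz : z ∈ Ω) (hw : w ∈ Ω) :
    Module.finrank ℂ (LinearMap.ker ((S - z • 1 : E →L[ℂ] E) : E →ₗ[ℂ] E)) =
      Module.finrank ℂ (LinearMap.ker ((S - w • 1 : E →L[ℂ] E) : E →ₗ[ℂ] E)) := by
  refine hΩ.constant (f := fun z =>
    Module.finrank ℂ (LinearMap.ker ((S - z • 1 : E →L[ℂ] E) : E →ₗ[ℂ] E))) ?_ hz hw
  intro z₀ hz₀
  refine ContinuousAt.continuousWithinAt ?_
  obtain ⟨R, hR⟩ := ContinuousLinearMap.hasRightInverse_of_range_eq_top (hS z₀ hz₀)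
  have hunit : ∀ᶠ z in nhds z₀, IsUnit (1 - (z - z₀) • R) := by
    have hc : ContinuousAt (fun z : ℂ => 1 - (z - z₀) • R) z₀ := by fun_prop
    have h1 : IsUnit (1 - (z₀ - z₀) • R) := by simp
    exact hc.eventually (Units.isOpen.mem_nhds h1)
  refine (continuousAt_const (y := Module.finrank ℂ
    (LinearMap.ker ((S - z₀ • 1 : E →L[ℂ] E) : E →ₗ[ℂ] E)))).congr ?_
  filter_upwards [hunit] with z hz
  obtain ⟨u, hu⟩ := hz
  let e : E ≃L[ℂ] E := ContinuousLinearEquiv.unitsEquiv ℂ E u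
  have he : ∀ x, e x = x - (z - z₀) • R x := by
    intro x
    change (u : E →L[ℂ] E) x = _
    rw [hu]; rfl
  -- The factorization `S - z = (S - z₀)(1 - (z - z₀) R)` has an invertible right factor for `z`
  -- near `z₀`.
  have hmap : (LinearMap.ker ((S - z • 1 : E →L[ℂ] E) : E →ₗ[ℂ] E)) =
      (LinearMap.ker ((S - z₀ • 1 : E →L[ℂ] E) : E →ₗ[ℂ] E)).comap
        (e.toLinearEquiv : E →ₗ[ℂ] E) := by
    ext x
    rw [Submodule.mem_comap, mem_ker_sub_smul, mem_ker_sub_smul]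
    have h1 : S (R x) - z₀ • R x = x := hR x
    change _ ↔ S (e x) = z₀ • e x
    rw [he, map_sub, map_smul, eq_add_of_sub_eq h1]
    constructor
    · intro h; rw [h]; module
    · intro h
      have := eq_add_of_sub_eq h
      rw [this]; module
  rw [hmap]
  have h := LinearEquiv.finrank_map_eq e.toLinearEquiv
    ((LinearMap.ker ((S - z₀ • 1 : E →L[ℂ] E) : E →ₗ[ℂ] E)).comap (e.toLinearEquiv : E →ₗ[ℂ] E))
  rwa [Submodule.map_comap_eq_of_surjective e.toLinearEquiv.surjective] at h

end KerDim

/-! ### Reducing subspaces of a Cowen–Douglas operator -/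

section Reducing

variable {H : Type*} [NormedAddCommGroup H] [InnerProductSpace ℂ H] [CompleteSpace H]
  {T : H →L[ℂ] H} {V W : Submodule ℂ H} {Ω : Set ℂ} {n : ℕ}

/-- `V` is a reducing subspace of `T`: closed, and invariant under `T` and its adjoint. -/
structure IsReducingSubspace (T : H →L[ℂ] H) (V : Submodule ℂ H) : Prop where
  isClosed : IsClosed (V : Set H)
  map_mem : ∀ x ∈ V, T x ∈ V
  adjoint_mem : ∀ x ∈ V, T.adjoint x ∈ V

/-- `V` is a minimal nonzero reducing subspace of `T`. -/
structure IsMinimalReducing (T : H →L[ℂ] H) (V : Submodule ℂ H) : Prop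
    extends IsReducingSubspace T V where
  ne_bot : V ≠ ⊥
  eq_bot_or_eq : ∀ W, IsReducingSubspace T W → W ≤ V → W = ⊥ ∨ W = V

namespace IsReducingSubspace

theorem completeSpace (hV : IsReducingSubspace T V) : CompleteSpace V :=
  hV.isClosed.completeSpace_coe

theorem top (T : H →L[ℂ] H) : IsReducingSubspace T ⊤ :=
  ⟨isClosed_univ, fun _ _ => Submodule.mem_top, fun _ _ => Submodule.mem_top⟩

theorem inf (hV : IsReducingSubspace T V) (hW : IsReducingSubspace T W) :
    IsReducingSubspace T (V ⊓ W) :=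
  ⟨hV.isClosed.inter hW.isClosed, fun x hx => ⟨hV.map_mem x hx.1, hW.map_mem x hx.2⟩,
    fun x hx => ⟨hV.adjoint_mem x hx.1, hW.adjoint_mem x hx.2⟩⟩

theorem orthogonal (hV : IsReducingSubspace T V) : IsReducingSubspace T Vᗮ := by
  refine ⟨V.isClosed_orthogonal, fun x hx => ?_, fun x hx => ?_⟩
  · rw [Submodule.mem_orthogonal] at hx ⊢
    intro y hy
    rw [← ContinuousLinearMap.adjoint_inner_left]
    exact hx _ (hV.adjoint_mem y hy)
  · rw [Submodule.mem_orthogonal] at hx ⊢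
    intro y hy
    rw [ContinuousLinearMap.adjoint_inner_right]
    exact hx _ (hV.map_mem y hy)

theorem starProjection_apply [V.HasOrthogonalProjection] (hV : IsReducingSubspace T V) (x : H) :
    V.starProjection (T x) = T (V.starProjection x) := by
  have h1 : T x = T (V.starProjection x) + T (x - V.starProjection x) := by
    rw [← map_add]; congr 1; abel
  rw [h1, map_add,
    Submodule.starProjection_eq_self_iff.2 (hV.map_mem _ (V.starProjection_apply_mem x)),
    (Submodule.starProjection_apply_eq_zero_iff V).2
      (hV.orthogonal.map_mem _ (V.sub_starProjection_mem_orthogonal x)), add_zero]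

/-- The restriction of an operator to a reducing subspace. -/
def restrict (hV : IsReducingSubspace T V) : V →L[ℂ] V := T.restrict hV.map_mem

theorem coe_restrict_apply (hV : IsReducingSubspace T V) (x : V) : (hV.restrict x : H) = T x := rfl

/-- The projection onto `V` commutes with `T`, so it turns a solution of `(T - z) x = y` with `y ∈
V` into a solution inside `V`. -/
theorem range_restrict_sub_smul (hV : IsReducingSubspace T V) {z : ℂ}
    (hz : LinearMap.range ((T - z • 1 : H →L[ℂ] H) : H →ₗ[ℂ] H) = ⊤) :
    LinearMap.range ((hV.restrict - z • 1 : V →L[ℂ] V) : V →ₗ[ℂ] V) = ⊤ := by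
  have := hV.completeSpace
  rw [eq_top_iff]
  intro y _
  obtain ⟨x, hx⟩ : (y : H) ∈ LinearMap.range ((T - z • 1 : H →L[ℂ] H) : H →ₗ[ℂ] H) :=
    hz ▸ Submodule.mem_top
  have hx' : T x - z • x = y := hx
  refine ⟨⟨V.starProjection x, V.starProjection_apply_mem x⟩, Subtype.ext ?_⟩
  change T (V.starProjection x) - z • V.starProjection x = y
  rw [← hV.starProjection_apply, ← map_smul, ← map_sub, hx',
    Submodule.starProjection_eq_self_iff.2 y.2]

/-- Eigenvectors of `T` project to eigenvectors in `V`, so a vector of `V` orthogonal to the latter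
is orthogonal to the former. -/
theorem topologicalClosure_iSup_ker_restrict (hV : IsReducingSubspace T V)
    (hT : (⨆ z ∈ Ω, LinearMap.ker ((T - z • 1 : H →L[ℂ] H) : H →ₗ[ℂ] H)).topologicalClosure = ⊤) :
    (⨆ z ∈ Ω, LinearMap.ker
      ((hV.restrict - z • 1 : V →L[ℂ] V) : V →ₗ[ℂ] V)).topologicalClosure = ⊤ := by
  have := hV.completeSpace
  rw [Submodule.topologicalClosure_eq_top_iff, eq_bot_iff]
  intro v hv
  rw [Submodule.mem_orthogonal] at hv
  have h1 : (v : H) ∈ (⨆ z ∈ Ω, LinearMap.ker ((T - z • 1 : H →L[ℂ] H) : H →ₗ[ℂ] H))ᗮ := by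
    suffices h : (⨆ z ∈ Ω, LinearMap.ker ((T - z • 1 : H →L[ℂ] H) : H →ₗ[ℂ] H)) ≤
        (ℂ ∙ (v : H))ᗮ from
      fun y hy => Submodule.mem_orthogonal_singleton_iff_inner_left.1 (h hy)
    refine iSup₂_le fun z hz y hy => Submodule.mem_orthogonal_singleton_iff_inner_left.2 ?_
    rw [mem_ker_sub_smul] at hy
    have h2 : (⟨V.starProjection y, V.starProjection_apply_mem y⟩ : V) ∈
        ⨆ z ∈ Ω, LinearMap.ker ((hV.restrict - z • 1 : V →L[ℂ] V) : V →ₗ[ℂ] V) := by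
      refine Submodule.mem_iSup_of_mem z (Submodule.mem_iSup_of_mem hz ?_)
      rw [mem_ker_sub_smul]
      refine Subtype.ext ?_
      change T (V.starProjection y) = z • V.starProjection y
      rw [← hV.starProjection_apply, hy, map_smul]
    have h3 : inner ℂ (V.starProjection y) (v : H) = 0 := hv _ h2
    rwa [V.inner_starProjection_left_eq_right, Submodule.starProjection_eq_self_iff.2 v.2] at h3
  rw [(Submodule.topologicalClosure_eq_top_iff).1 hT] at h1
  exact Subtype.ext h1

theorem isCowenDouglas_restrict (hV : IsReducingSubspace T V) (hΩ : IsPreconnected Ω)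
    (hT : IsCowenDouglas Ω n T) (hne : V ≠ ⊥) {z₀ : ℂ} (hz₀ : z₀ ∈ Ω) :
    IsCowenDouglas Ω (Module.finrank ℂ (LinearMap.ker
      ((hV.restrict - z₀ • 1 : V →L[ℂ] V) : V →ₗ[ℂ] V))) hV.restrict := by
  have := hV.completeSpace
  have hrange z hz := hV.range_restrict_sub_smul (z := z) (hT.range_eq_top z hz)
  have hspan := hV.topologicalClosure_iSup_ker_restrict hT.span_ker
  -- Needed so that a `finrank` of zero below means a trivial kernel rather than an
  -- infinite-dimensional one.
  have hfin : ∀ z ∈ Ω, FiniteDimensional ℂ (LinearMap.ker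
      ((hV.restrict - z • 1 : V →L[ℂ] V) : V →ₗ[ℂ] V)) := by
    intro z hz
    have : FiniteDimensional ℂ (LinearMap.ker ((T - z • 1 : H →L[ℂ] H) : H →ₗ[ℂ] H)) :=
      Module.finite_of_finrank_pos (by rw [hT.finrank_ker z hz]; exact hT.pos)
    refine Module.Finite.of_injective ((V.subtype.restrict
      (p := LinearMap.ker ((hV.restrict - z • 1 : V →L[ℂ] V) : V →ₗ[ℂ] V))
      (q := LinearMap.ker ((T - z • 1 : H →L[ℂ] H) : H →ₗ[ℂ] H)) fun x hx => ?_)) ?_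
    · rw [mem_ker_sub_smul] at hx ⊢
      exact congrArg Subtype.val hx
    · intro x y hxy
      have : ((x : V) : H) = ((y : V) : H) := congrArg (fun w => (w.1 : H)) hxy
      exact Subtype.ext (Subtype.ext this)
  have hconst z hz := finrank_ker_sub_smul_eq hΩ hrange (z := z) hz hz₀
  have hpos : 0 < Module.finrank ℂ (LinearMap.ker
      ((hV.restrict - z₀ • 1 : V →L[ℂ] V) : V →ₗ[ℂ] V)) := by
    by_contra hzero
    have hzero := Nat.eq_zero_of_not_pos hzero
    have hbot : ∀ z ∈ Ω, LinearMap.ker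
        ((hV.restrict - z • 1 : V →L[ℂ] V) : V →ₗ[ℂ] V) = ⊥ := by
      intro z hz
      have := hfin z hz
      rw [← Submodule.finrank_eq_zero (R := ℂ), hconst z hz, hzero]
    rw [biSup_congr hbot, Submodule.topologicalClosure_eq_top_iff] at hspan
    simp only [iSup_bot, Submodule.bot_orthogonal_eq_top] at hspan
    apply hne
    rw [eq_bot_iff]
    intro x hx
    have : (⟨x, hx⟩ : V) ∈ (⊥ : Submodule ℂ V) := hspan ▸ Submodule.mem_top
    exact congrArg Subtype.val ((Submodule.mem_bot ℂ).1 this)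
  refine ⟨hpos, fun z hz => ?_, hrange, hspan, hconst⟩
  have hnt : Nontrivial (LinearMap.ker ((hV.restrict - z • 1 : V →L[ℂ] V) : V →ₗ[ℂ] V)) :=
    Module.nontrivial_of_finrank_pos (R := ℂ) (by rw [hconst z hz]; exact hpos)
  obtain ⟨x, hx⟩ := exists_ne
    (0 : LinearMap.ker ((hV.restrict - z • 1 : V →L[ℂ] V) : V →ₗ[ℂ] V))
  rw [spectrum.mem_iff, Algebra.algebraMap_eq_smul_one]
  intro hu
  obtain ⟨y, hy⟩ := hu.exists_left_inv
  apply hx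
  refine Subtype.ext ?_
  have h1 : (z • 1 - hV.restrict : V →L[ℂ] V) x = 0 := by
    have := mem_ker_sub_smul.1 x.2
    change z • (x : V) - hV.restrict x = 0
    rw [this, sub_self]
  have h2 : (y * (z • 1 - hV.restrict) : V →L[ℂ] V) x = x := by rw [hy]; rfl
  rw [← h2]
  change y ((z • 1 - hV.restrict : V →L[ℂ] V) x) = 0
  rw [h1, map_zero]

theorem eq_bot_of_inf_ker_eq_bot (hV : IsReducingSubspace T V) (hΩ : IsPreconnected Ω)
    (hT : IsCowenDouglas Ω n T) {z₀ : ℂ} (hz₀ : z₀ ∈ Ω)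
    (h : V ⊓ LinearMap.ker ((T - z₀ • 1 : H →L[ℂ] H) : H →ₗ[ℂ] H) = ⊥) : V = ⊥ := by
  by_contra hne
  have hpos := (hV.isCowenDouglas_restrict hΩ hT hne hz₀).pos
  have hnt := Module.nontrivial_of_finrank_pos hpos
  obtain ⟨x, hx⟩ := exists_ne
    (0 : LinearMap.ker ((hV.restrict - z₀ • 1 : V →L[ℂ] V) : V →ₗ[ℂ] V))
  have h1 : ((x : V) : H) ∈ V ⊓ LinearMap.ker ((T - z₀ • 1 : H →L[ℂ] H) : H →ₗ[ℂ] H) :=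
    ⟨(x : V).2, mem_ker_sub_smul.2 (congrArg Subtype.val (mem_ker_sub_smul.1 x.2))⟩
  rw [h] at h1
  exact hx (Subtype.ext (Subtype.ext h1))

/-- A proper reducing subspace meets `ker (T - z₀)` in a space of smaller dimension. -/
theorem finrank_inf_ker_lt (hV : IsReducingSubspace T V) (hW : IsReducingSubspace T W)
    (hΩ : IsPreconnected Ω) (hT : IsCowenDouglas Ω n T) {z₀ : ℂ} (hz₀ : z₀ ∈ Ω) (hlt : W < V) :
    Module.finrank ℂ ↥(W ⊓ LinearMap.ker ((T - z₀ • 1 : H →L[ℂ] H) : H →ₗ[ℂ] H)) <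
      Module.finrank ℂ ↥(V ⊓ LinearMap.ker ((T - z₀ • 1 : H →L[ℂ] H) : H →ₗ[ℂ] H)) := by
  have := hW.completeSpace
  have hfin : FiniteDimensional ℂ (LinearMap.ker ((T - z₀ • 1 : H →L[ℂ] H) : H →ₗ[ℂ] H)) :=
    Module.finite_of_finrank_pos (by rw [hT.finrank_ker z₀ hz₀]; exact hT.pos)
  have : FiniteDimensional ℂ ↥(V ⊓ LinearMap.ker ((T - z₀ • 1 : H →L[ℂ] H) : H →ₗ[ℂ] H)) :=
    Submodule.finiteDimensional_of_le inf_le_right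
  refine Submodule.finrank_lt_finrank_of_lt
    (lt_of_le_of_ne (inf_le_inf_right _ hlt.le) fun heq => hlt.ne ?_)
  -- If `V` and `W` meet the kernel in the same space, the part of `V` orthogonal to `W` contains no
  -- eigenvector at `z₀`, hence is zero.
  have h1 : V ⊓ Wᗮ = ⊥ := by
    refine (hV.inf hW.orthogonal).eq_bot_of_inf_ker_eq_bot hΩ hT hz₀ ?_
    rw [eq_bot_iff, ← W.inf_orthogonal_eq_bot]
    rintro x ⟨⟨hxV, hxW⟩, hxk⟩
    have : x ∈ W ⊓ LinearMap.ker ((T - z₀ • 1 : H →L[ℂ] H) : H →ₗ[ℂ] H) := heq ▸ ⟨hxV, hxk⟩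
    exact ⟨this.1, hxW⟩
  have h2 := Submodule.sup_orthogonal_inf_of_hasOrthogonalProjection hlt.le
  rwa [inf_comm, h1, sup_bot_eq] at h2

/-- A reducing subspace is a finite orthogonal sum of minimal ones. -/
theorem exists_finset_isMinimalReducing (hΩ : IsPreconnected Ω) (hT : IsCowenDouglas Ω n T)
    {z₀ : ℂ} (hz₀ : z₀ ∈ Ω) (hV : IsReducingSubspace T V) :
    ∃ s : Finset (Submodule ℂ H), (∀ W ∈ s, IsMinimalReducing T W) ∧
      (s : Set (Submodule ℂ H)).Pairwise (· ⟂ ·) ∧ s.sup id = V := by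
  classical
  -- Both halves of a proper splitting of `V` have strictly smaller kernel dimension.
  induction hk : Module.finrank ℂ ↥(V ⊓ LinearMap.ker ((T - z₀ • 1 : H →L[ℂ] H) : H →ₗ[ℂ] H))
    using Nat.strong_induction_on generalizing V with
  | _ k ih =>
    by_cases hbot : V = ⊥
    · exact ⟨∅, by simp, by simp, by simp [hbot]⟩
    by_cases hmin : ∀ W, IsReducingSubspace T W → W ≤ V → W = ⊥ ∨ W = V
    · exact ⟨{V}, by simpa using ⟨hV, hbot, hmin⟩, by simp, by simp⟩
    push Not at hmin
    obtain ⟨W, hW, hWV, hW0, hW1⟩ := hmin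
    have := hW.completeSpace
    have hW' := hV.inf hW.orthogonal
    have hsup : W ⊔ V ⊓ Wᗮ = V := by
      rw [inf_comm, Submodule.sup_orthogonal_inf_of_hasOrthogonalProjection hWV]
    have hlt : V ⊓ Wᗮ < V := by
      refine lt_of_le_of_ne inf_le_left fun h => hW0 ?_
      rw [eq_bot_iff, ← W.inf_orthogonal_eq_bot]
      exact le_inf le_rfl (hWV.trans (inf_eq_left.1 h))
    obtain ⟨s, hs, hs', rfl⟩ := ih _
      (hk ▸ hV.finrank_inf_ker_lt hW hΩ hT hz₀ (lt_of_le_of_ne hWV hW1)) hW rfl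
    obtain ⟨s', ht, ht', hsup'⟩ := ih _ (hk ▸ hV.finrank_inf_ker_lt hW' hΩ hT hz₀ hlt) hW' rfl
    refine ⟨s ∪ s', fun U hU => (Finset.mem_union.1 hU).elim (hs U) (ht U), ?_, ?_⟩
    · rw [Finset.coe_union, Set.pairwise_union_of_symm]
      refine ⟨hs', ht', fun A hA B hB _ => ?_⟩
      have h1 : A ≤ s.sup id := Finset.le_sup (f := id) hA
      have h2 : B ≤ s'.sup id := Finset.le_sup (f := id) hB
      exact (Submodule.isOrtho_orthogonal_right _).mono h1 (h2.trans (hsup' ▸ inf_le_right))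
    · rw [Finset.sup_union, hsup', hsup]

end IsReducingSubspace

/-- The range of a projection commuting with the restriction is a reducing subspace of `T` inside
`V`; minimality leaves only the trivial choices. -/
theorem IsMinimalReducing.isIrreducibleOperator [CompleteSpace V] (hV : IsMinimalReducing T V) :
    IsIrreducibleOperator hV.toIsReducingSubspace.restrict := by
  intro P hPs hPi hPT
  have hPP : ∀ x, P (P x) = P x := fun x => congrArg (fun S : V →L[ℂ] V => S x) hPi
  have hPT' : ∀ x : V, ((P (hV.restrict x) : V) : H) = T (P x) := fun x =>
    congrArg (fun S : V →L[ℂ] V => ((S x : V) : H)) hPT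
  have hsymm : ∀ x y, inner ℂ (P x) y = inner ℂ x (P y) := hPs.isSymmetric
  let W : Submodule ℂ H := (LinearMap.eqLocus (P : V →ₗ[ℂ] V) LinearMap.id).map V.subtype
  have hmem : ∀ x : V, (x : H) ∈ W ↔ P x = x := by
    intro x
    constructor
    · rintro ⟨y, hy, hyx⟩
      obtain rfl : y = x := Subtype.ext hyx
      exact hy
    · intro h
      exact ⟨x, h, rfl⟩
  have hWV : W ≤ V := by
    rintro _ ⟨y, -, rfl⟩
    exact y.2
  have hW : IsReducingSubspace T W := by
    refine ⟨?_, ?_, ?_⟩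
    · refine hV.isClosed.isClosedEmbedding_subtypeVal.isClosedMap _ ?_
      exact isClosed_eq P.continuous continuous_id
    · intro x hx
      obtain ⟨x, rfl⟩ : ∃ y : V, (y : H) = x := ⟨⟨x, hWV hx⟩, rfl⟩
      rw [hmem] at hx
      rw [← hV.coe_restrict_apply, hmem]
      refine Subtype.ext ?_
      rw [hPT', hx]; rfl
    · intro x hx
      obtain ⟨x, rfl⟩ : ∃ y : V, (y : H) = x := ⟨⟨x, hWV hx⟩, rfl⟩
      rw [hmem] at hx
      refine (hmem ⟨T.adjoint x, hV.adjoint_mem _ x.2⟩).2 ?_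
      refine ext_inner_right ℂ fun y => ?_
      rw [hsymm]
      change inner ℂ (T.adjoint x) ((P y : V) : H) = inner ℂ (T.adjoint x) (y : H)
      rw [ContinuousLinearMap.adjoint_inner_left, ContinuousLinearMap.adjoint_inner_left, ← hPT']
      change inner ℂ x (P (hV.restrict y)) = inner ℂ x (hV.restrict y)
      rw [← hsymm, hx]
  rcases hV.eq_bot_or_eq W hW hWV with h | h
  · left
    ext x
    have : ((P x : V) : H) ∈ W := (hmem _).2 (hPP x)
    rw [h] at this
    exact this
  · right
    ext x
    exact congrArg Subtype.val ((hmem x).1 (by rw [h]; exact x.2))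

end Reducing

/-! ### Unitary equivalence and kernels of direct sums -/

namespace UnitarilyEquivalent

variable {H : Type*} [NormedAddCommGroup H] [InnerProductSpace ℂ H]
  {K : Type*} [NormedAddCommGroup K] [InnerProductSpace ℂ K]
  {L : Type*} [NormedAddCommGroup L] [InnerProductSpace ℂ L]
  {T : H →L[ℂ] H} {S : K →L[ℂ] K} {R : L →L[ℂ] L}

theorem refl (T : H →L[ℂ] H) : UnitarilyEquivalent T T :=
  ⟨LinearIsometryEquiv.refl ℂ H, fun _ => rfl⟩

theorem symm (h : UnitarilyEquivalent T S) : UnitarilyEquivalent S T := by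
  obtain ⟨U, hU⟩ := h
  refine ⟨U.symm, fun x => U.injective ?_⟩
  rw [hU, U.apply_symm_apply, U.apply_symm_apply]

theorem trans (h : UnitarilyEquivalent T S) (h' : UnitarilyEquivalent S R) :
    UnitarilyEquivalent T R := by
  obtain ⟨U, hU⟩ := h
  obtain ⟨V, hV⟩ := h'
  refine ⟨U.trans V, fun x => ?_⟩
  simp [hU, hV]

theorem finrank_ker_eq (h : UnitarilyEquivalent T S) (z : ℂ) :
    Module.finrank ℂ (LinearMap.ker ((T - z • 1 : H →L[ℂ] H) : H →ₗ[ℂ] H)) =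
      Module.finrank ℂ (LinearMap.ker ((S - z • 1 : K →L[ℂ] K) : K →ₗ[ℂ] K)) := by
  obtain ⟨U, hU⟩ := h
  suffices hmap : (LinearMap.ker ((T - z • 1 : H →L[ℂ] H) : H →ₗ[ℂ] H)).map
      (U.toLinearEquiv : H →ₗ[ℂ] K) = LinearMap.ker ((S - z • 1 : K →L[ℂ] K) : K →ₗ[ℂ] K) by
    rw [← hmap]
    exact (LinearEquiv.finrank_map_eq U.toLinearEquiv _).symm
  ext y
  rw [mem_ker_sub_smul]
  constructor
  · rintro ⟨x, hx, rfl⟩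
    have hx' := mem_ker_sub_smul.1 hx
    change S (U x) = z • U x
    rw [← hU, hx', map_smul]
  · intro hy
    refine ⟨U.symm y, mem_ker_sub_smul.2 (U.injective ?_), U.apply_symm_apply y⟩
    rw [hU, map_smul, U.apply_symm_apply, hy]

theorem directSum {ι : Type*} [Fintype ι] {E F : ι → Type*}
    [∀ i, NormedAddCommGroup (E i)] [∀ i, InnerProductSpace ℂ (E i)]
    [∀ i, NormedAddCommGroup (F i)] [∀ i, InnerProductSpace ℂ (F i)]
    {A : ∀ i, E i →L[ℂ] E i} {B : ∀ i, F i →L[ℂ] F i} (h : ∀ i, UnitarilyEquivalent (A i) (B i)) :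
    UnitarilyEquivalent (directSumOperator A) (directSumOperator B) := by
  choose U hU using h
  refine ⟨LinearIsometryEquiv.piLpCongrRight 2 U, fun x => ?_⟩
  ext i
  exact hU i (x i)

end UnitarilyEquivalent

theorem finrank_ker_directSumOperator {ι : Type*} [Fintype ι] {E : ι → Type*}
    [∀ i, NormedAddCommGroup (E i)] [∀ i, InnerProductSpace ℂ (E i)]
    (A : ∀ i, E i →L[ℂ] E i) (z : ℂ)
    [∀ i, FiniteDimensional ℂ (LinearMap.ker ((A i - z • 1 : E i →L[ℂ] E i) : E i →ₗ[ℂ] E i))] :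
    Module.finrank ℂ (LinearMap.ker
      ((directSumOperator A - z • 1 : PiLp 2 E →L[ℂ] PiLp 2 E) : PiLp 2 E →ₗ[ℂ] PiLp 2 E)) =
      ∑ i, Module.finrank ℂ
        (LinearMap.ker ((A i - z • 1 : E i →L[ℂ] E i) : E i →ₗ[ℂ] E i)) := by
  rw [← Module.finrank_pi_fintype ℂ]
  refine LinearEquiv.finrank_eq
    { toFun := fun x i => ⟨x.1 i, mem_ker_sub_smul.2 ?_⟩
      invFun := fun y => ⟨WithLp.toLp 2 fun i => (y i).1, mem_ker_sub_smul.2 ?_⟩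
      map_add' := fun _ _ => rfl
      map_smul' := fun _ _ => rfl
      left_inv := fun _ => rfl
      right_inv := fun _ => rfl }
  · exact congrArg (fun w : PiLp 2 E => w i) (mem_ker_sub_smul.1 x.2)
  · ext i
    exact mem_ker_sub_smul.1 (y i).2

theorem IsCowenDouglas.finiteDimensional_ker {H : Type*} [NormedAddCommGroup H]
    [InnerProductSpace ℂ H] {Ω : Set ℂ} {n : ℕ} {T : H →L[ℂ] H} (hT : IsCowenDouglas Ω n T)
    {z : ℂ} (hz : z ∈ Ω) :
    FiniteDimensional ℂ (LinearMap.ker ((T - z • 1 : H →L[ℂ] H) : H →ₗ[ℂ] H)) :=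
  Module.finite_of_finrank_pos (by rw [hT.finrank_ker z hz]; exact hT.pos)

/-! ### Existence of the decomposition -/

section Existence

variable {H : Type u} [NormedAddCommGroup H] [InnerProductSpace ℂ H] [CompleteSpace H]
  {T : H →L[ℂ] H} {Ω : Set ℂ} {n : ℕ}

/-- An operator is the orthogonal direct sum of its restrictions to a finite orthogonal family of
reducing subspaces that span the space. -/
theorem unitarilyEquivalent_directSumOperator_restrict {ι : Type*} [Fintype ι]
    {V : ι → Submodule ℂ H} (hV : ∀ i, IsReducingSubspace T (V i))
    (horth : Pairwise fun i j => V i ⟂ V j) (hsup : ⨆ i, V i = ⊤) :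
    UnitarilyEquivalent T (directSumOperator fun i => (hV i).restrict) := by
  classical
  have hfam : OrthogonalFamily ℂ (fun i => V i) fun i => (V i).subtypeₗᵢ :=
    OrthogonalFamily.of_pairwise horth
  have hint : DirectSum.IsInternal V :=
    DirectSum.isInternal_submodule_of_iSupIndep_of_iSup_eq_top hfam.independent hsup
  refine UnitarilyEquivalent.symm ⟨(hint.isometryL2OfOrthogonalFamily hfam).symm, fun w => ?_⟩
  rw [hint.isometryL2OfOrthogonalFamily_symm_apply hfam,
    hint.isometryL2OfOrthogonalFamily_symm_apply hfam, map_sum]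
  rfl

theorem IsCowenDouglas.nonempty_irDecomposition (hΩ : IsConnected Ω)
    (hT : IsCowenDouglas Ω n T) : Nonempty (IRDecomposition.{u, u} Ω n T) := by
  classical
  obtain ⟨z₀, hz₀⟩ := hΩ.nonempty
  obtain ⟨s, hs, horth, hsup⟩ :=
    (IsReducingSubspace.top T).exists_finset_isMinimalReducing hΩ.isPreconnected hT hz₀
  have hred : ∀ W : s, IsReducingSubspace T W.1 := fun W => (hs W W.2).toIsReducingSubspace
  let r : Setoid s :=
    { r := fun W W' => UnitarilyEquivalent (hred W).restrict (hred W').restrict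
      iseqv := ⟨fun _ => .refl _, fun h => h.symm, fun h h' => h.trans h'⟩ }
  let e : Quotient r ≃ Fin (Fintype.card (Quotient r)) := Fintype.equivFin _
  let cls : s → Fin (Fintype.card (Quotient r)) := fun W => e (Quotient.mk r W)
  let rep : Fin (Fintype.card (Quotient r)) → s := fun i => (e.symm i).out
  have hrep : ∀ i, cls (rep i) = i := fun i => by simp [cls, rep]
  have hcls : ∀ W W', cls W = cls W' ↔
      UnitarilyEquivalent (hred W).restrict (hred W').restrict := fun W W' => by
    simp only [cls, e.apply_eq_iff_eq]
    exact Quotient.eq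
  let mult : Fin (Fintype.card (Quotient r)) → ℕ := fun i => Fintype.card {W : s // cls W = i}
  -- Enumerates the minimal subspaces class by class; each is then replaced by the representative of
  -- its class.
  let σ : (Σ i, Fin (mult i)) ≃ s :=
    (Equiv.sigmaCongrRight fun i => (Fintype.equivFin {W : s // cls W = i}).symm).trans
      (Equiv.sigmaFiberEquiv cls)
  have hσ : ∀ p, cls (σ p) = p.1 := fun p => ((Fintype.equivFin {W : s // cls W = p.1}).symm p.2).2
  have hcd : ∀ W : s, IsCowenDouglas Ω _ (hred W).restrict := fun W =>
    (hred W).isCowenDouglas_restrict hΩ.isPreconnected hT (hs W W.2).ne_bot hz₀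
  have hequiv : UnitarilyEquivalent T
      (directSumOperator fun p : (Σ i, Fin (mult i)) => (hred (rep p.1)).restrict) := by
    refine (unitarilyEquivalent_directSumOperator_restrict (V := fun p => (σ p).1)
      (fun p => hred (σ p)) ?_ ?_).trans (.directSum fun p => ?_)
    · intro p q hpq
      exact horth (σ p).2 (σ q).2 fun h => hpq (σ.injective (Subtype.ext h))
    · rw [σ.iSup_comp (g := fun W : s => W.1), ← hsup, Finset.sup_id_eq_sSup, sSup_eq_iSup']
      rfl
    · rw [← hcls, hσ, hrep]
  have hfin : ∀ p : (Σ i, Fin (mult i)), FiniteDimensional ℂ (LinearMap.ker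
      (((hred (rep p.1)).restrict - z₀ • 1 : (rep p.1).1 →L[ℂ] (rep p.1).1) :
        (rep p.1).1 →ₗ[ℂ] (rep p.1).1)) := fun p => (hcd (rep p.1)).finiteDimensional_ker hz₀
  let rank : Fin (Fintype.card (Quotient r)) → ℕ := fun i => Module.finrank ℂ (LinearMap.ker
    (((hred (rep i)).restrict - z₀ • 1 : (rep i).1 →L[ℂ] (rep i).1) :
      (rep i).1 →ₗ[ℂ] (rep i).1))
  -- Both sides are the dimension of the kernel at `z₀`.
  have hsum : ∑ i, mult i * rank i = n := by
    have h : n = ∑ p : (Σ i, Fin (mult i)), rank p.1 := by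
      rw [← hT.finrank_ker z₀ hz₀, hequiv.finrank_ker_eq z₀, finrank_ker_directSumOperator]
    rw [h, Fintype.sum_sigma]
    simp only [Finset.sum_const, Finset.card_univ, Fintype.card_fin, smul_eq_mul]
  exact ⟨{
    t := Fintype.card (Quotient r)
    space := fun i => (rep i).1
    normedAddCommGroup := fun i => inferInstance
    innerProductSpace := fun i => inferInstance
    completeSpace := fun i => (hred (rep i)).completeSpace
    summand := fun i => (hred (rep i)).restrict
    mult := mult
    rank := rank
    mult_pos := fun i => Fintype.card_pos_iff.2 ⟨⟨rep i, hrep i⟩⟩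
    cowenDouglas := fun i => hcd (rep i)
    sum_eq := hsum
    irreducible := fun i =>
      have := (hred (rep i)).completeSpace
      (hs (rep i) (rep i).2).isIrreducibleOperator
    not_equiv := fun i j hij h => hij (by rw [← hrep i, ← hrep j, hcls]; exact h)
    eq_directSum := hequiv }⟩

end Existence

/-! ### Blocks of a unitary intertwiner -/

section Intertwiner

variable {ι : Type*} [DecidableEq ι] {E : ι → Type*}
  [∀ i, NormedAddCommGroup (E i)] [∀ i, InnerProductSpace ℂ (E i)]
  {κ : Type*} [DecidableEq κ] {F : κ → Type*}
  [∀ k, NormedAddCommGroup (F k)] [∀ k, InnerProductSpace ℂ (F k)]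

/-- The inclusion of a summand into a finite Hilbert direct sum. -/
noncomputable def piLpSingle (E : ι → Type*) [∀ i, NormedAddCommGroup (E i)]
    [∀ i, InnerProductSpace ℂ (E i)] (i : ι) : E i →L[ℂ] PiLp 2 E :=
  ((PiLp.continuousLinearEquiv 2 ℂ E).symm : (∀ i, E i) →L[ℂ] PiLp 2 E) ∘L
    ContinuousLinearMap.single ℂ E i

theorem piLpSingle_apply (i j : ι) (x : E i) : piLpSingle E i x j = Pi.single i x j := rfl

theorem piLpSingle_apply_same (i : ι) (x : E i) : piLpSingle E i x i = x := by
  rw [piLpSingle_apply, Pi.single_eq_same]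

theorem piLpSingle_apply_of_ne {i j : ι} (h : j ≠ i) (x : E i) : piLpSingle E i x j = 0 := by
  rw [piLpSingle_apply, Pi.single_eq_of_ne h]

variable [Fintype ι] [Fintype κ]

theorem inner_piLpSingle_left (i : ι) (x : E i) (y : PiLp 2 E) :
    inner ℂ (piLpSingle E i x) y = inner ℂ x (y i) := by
  rw [PiLp.inner_apply, Finset.sum_eq_single i]
  · rw [piLpSingle_apply_same]
  · intro j _ hj
    rw [piLpSingle_apply_of_ne hj, inner_zero_left]
  · simp

theorem inner_piLpSingle_right (i : ι) (x : E i) (y : PiLp 2 E) :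
    inner ℂ y (piLpSingle E i x) = inner ℂ (y i) x := by
  rw [← inner_conj_symm, inner_piLpSingle_left, inner_conj_symm]

theorem directSumOperator_piLpSingle (A : ∀ i, E i →L[ℂ] E i) (i : ι) (x : E i) :
    directSumOperator A (piLpSingle E i x) = piLpSingle E i (A i x) := by
  ext j
  rw [directSumOperator_apply]
  rcases eq_or_ne j i with rfl | h
  · rw [piLpSingle_apply_same, piLpSingle_apply_same]
  · rw [piLpSingle_apply_of_ne h, piLpSingle_apply_of_ne h, map_zero]

/-- A unitary intertwiner of direct sums of irreducible operators has zero entries between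
summands that are not unitarily equivalent. -/
theorem intertwiner_piLpSingle_apply_eq_zero [∀ i, CompleteSpace (E i)] [∀ k, CompleteSpace (F k)]
    {A : ∀ i, E i →L[ℂ] E i} {B : ∀ k, F k →L[ℂ] F k}
    (hA : ∀ i, IsIrreducibleOperator (A i)) (hB : ∀ k, IsIrreducibleOperator (B k))
    (W : PiLp 2 E ≃ₗᵢ[ℂ] PiLp 2 F)
    (hW : ∀ x, W (directSumOperator A x) = directSumOperator B (W x)) {i : ι} {k : κ}
    (h : ¬ UnitarilyEquivalent (A i) (B k)) (x : E i) : W (piLpSingle E i x) k = 0 := by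
  have hW' : ∀ y, W.symm (directSumOperator B y) = directSumOperator A (W.symm y) := fun y =>
    W.injective (by rw [hW, W.apply_symm_apply, W.apply_symm_apply])
  let X : E i →L[ℂ] F k :=
    PiLp.proj 2 F k ∘L (W.toContinuousLinearEquiv : PiLp 2 E →L[ℂ] PiLp 2 F) ∘L piLpSingle E i
  let Y : F k →L[ℂ] E i :=
    PiLp.proj 2 E i ∘L (W.symm.toContinuousLinearEquiv : PiLp 2 F →L[ℂ] PiLp 2 E) ∘L
      piLpSingle F k
  have hX : ∀ x, X x = W (piLpSingle E i x) k := fun _ => rfl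
  have hY : ∀ y, Y y = W.symm (piLpSingle F k y) i := fun _ => rfl
  -- As `W` is unitary, the adjoint of its block is the opposite block of `W.symm`, which
  -- intertwines in the other direction, as Schur's lemma requires.
  have hadj : X.adjoint = Y := by
    symm
    rw [ContinuousLinearMap.eq_adjoint_iff]
    intro y x
    have h1 := W.inner_map_map (W.symm (piLpSingle F k y)) (piLpSingle E i x)
    rw [W.apply_symm_apply, inner_piLpSingle_left, inner_piLpSingle_right] at h1
    exact h1.symm
  by_contra hx
  refine h ((hA i).unitarilyEquivalent (hB k) (X := X) (fun x => ?_) (fun y => ?_) fun h0 => hx ?_)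
  · rw [hX, ← directSumOperator_piLpSingle, hW, directSumOperator_apply, hX]
  · rw [hadj, hY, ← directSumOperator_piLpSingle, hW', directSumOperator_apply, hY]
  · rw [← hX, h0]; rfl

end Intertwiner

/-! ### Uniqueness of the decomposition -/

namespace IRDecomposition

variable {H : Type u} [NormedAddCommGroup H] [InnerProductSpace ℂ H]
  {H' : Type u'} [NormedAddCommGroup H'] [InnerProductSpace ℂ H']
  {Ω : Set ℂ} {n n' : ℕ} {T : H →L[ℂ] H} {T' : H' →L[ℂ] H'}

theorem exists_intertwiner (D : IRDecomposition.{u, v} Ω n T) (D' : IRDecomposition.{u', v'} Ω n' T')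
    (h : UnitarilyEquivalent T T') :
    UnitarilyEquivalent (directSumOperator fun p : (Σ i, Fin (D.mult i)) => D.summand p.1)
      (directSumOperator fun p : (Σ i, Fin (D'.mult i)) => D'.summand p.1) :=
  (D.eq_directSum.symm.trans h).trans D'.eq_directSum

/-- Without a partner, all blocks of the unitary out of one copy of the summand would vanish, so it
would kill an eigenvector in that copy. -/
theorem exists_unitarilyEquivalent_summand (D : IRDecomposition.{u, v} Ω n T)
    (D' : IRDecomposition.{u', v'} Ω n' T') (hΩ : Ω.Nonempty) (h : UnitarilyEquivalent T T')
    (i : Fin D.t) : ∃ j, UnitarilyEquivalent (D.summand i) (D'.summand j) := by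
  obtain ⟨z, hz⟩ := hΩ
  obtain ⟨W, hW⟩ := D.exists_intertwiner D' h
  by_contra! hne
  have hpos := (D.cowenDouglas i).pos
  rw [← (D.cowenDouglas i).finrank_ker z hz] at hpos
  have hnt := Module.nontrivial_of_finrank_pos hpos
  obtain ⟨x, hx⟩ := exists_ne (0 : LinearMap.ker
    ((D.summand i - z • 1 : D.space i →L[ℂ] D.space i) : D.space i →ₗ[ℂ] D.space i))
  let p : (Σ i, Fin (D.mult i)) := ⟨i, ⟨0, D.mult_pos i⟩⟩
  let x' : D.space p.1 := x.1
  have h0 : W (piLpSingle (fun p : (Σ i, Fin (D.mult i)) => D.space p.1) p x') = 0 := by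
    ext q
    exact intertwiner_piLpSingle_apply_eq_zero (fun p => D.irreducible p.1)
      (fun q => D'.irreducible q.1) W hW (hne q.1) x'
  rw [map_eq_zero_iff W W.injective] at h0
  have h1 := piLpSingle_apply_same (E := fun p : (Σ i, Fin (D.mult i)) => D.space p.1) p x'
  rw [h0] at h1
  exact hx (Subtype.ext h1.symm)

/-- The unitary injects the `z`-eigenvectors of the copies of `T_i` into those of the copies of its
partner. Both summands have the same positive kernel dimension, which cancels. -/
theorem mult_le (D : IRDecomposition.{u, v} Ω n T) (D' : IRDecomposition.{u', v'} Ω n' T')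
    (hΩ : Ω.Nonempty) (h : UnitarilyEquivalent T T') {i : Fin D.t} {j : Fin D'.t}
    (hij : UnitarilyEquivalent (D.summand i) (D'.summand j)) : D.mult i ≤ D'.mult j := by
  obtain ⟨z, hz⟩ := hΩ
  obtain ⟨W, hW⟩ := D.exists_intertwiner D' h
  let E : (Σ i, Fin (D.mult i)) → Type v := fun p => D.space p.1
  let K := LinearMap.ker
    ((D.summand i - z • 1 : D.space i →L[ℂ] D.space i) : D.space i →ₗ[ℂ] D.space i)
  let K' := LinearMap.ker
    ((D'.summand j - z • 1 : D'.space j →L[ℂ] D'.space j) : D'.space j →ₗ[ℂ] D'.space j)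
  have : FiniteDimensional ℂ K := (D.cowenDouglas i).finiteDimensional_ker hz
  have : FiniteDimensional ℂ K' := (D'.cowenDouglas j).finiteDimensional_ker hz
  let emb : (Fin (D.mult i) → K) →ₗ[ℂ] PiLp 2 E :=
    ∑ k, (piLpSingle E ⟨i, k⟩ : D.space i →ₗ[ℂ] PiLp 2 E) ∘ₗ K.subtype ∘ₗ LinearMap.proj k
  have hemb : ∀ y, emb y = ∑ k, piLpSingle E ⟨i, k⟩ (y k : D.space i) := fun y => by
    simp [emb]
  have hembk : ∀ y k, emb y ⟨i, k⟩ = (y k : D.space i) := by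
    intro y k
    rw [hemb, WithLp.ofLp_sum, Finset.sum_apply, Finset.sum_eq_single k]
    · exact piLpSingle_apply_same (E := E) ⟨i, k⟩ _
    · intro l _ hl
      exact piLpSingle_apply_of_ne (E := E) (by simpa using hl.symm) _
    · simp
  have hembT : ∀ y, directSumOperator (fun p : (Σ i, Fin (D.mult i)) => D.summand p.1) (emb y) =
      z • emb y := by
    intro y
    rw [hemb, map_sum, Finset.smul_sum]
    refine Finset.sum_congr rfl fun k _ => ?_
    rw [directSumOperator_piLpSingle, ← map_smul]
    congr 1
    exact mem_ker_sub_smul.1 (y k).2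
  -- A nonzero component elsewhere would make two distinct summands of `D'` equivalent through
  -- `D.summand i`.
  have hzero : ∀ y (q : Σ i, Fin (D'.mult i)), q.1 ≠ j → W (emb y) q = 0 := by
    intro y q hq
    rw [hemb, map_sum, WithLp.ofLp_sum, Finset.sum_apply]
    refine Finset.sum_eq_zero fun k _ => ?_
    refine intertwiner_piLpSingle_apply_eq_zero (fun p => D.irreducible p.1)
      (fun q => D'.irreducible q.1) W hW (i := ⟨i, k⟩) (fun hiq => ?_) _
    exact D'.not_equiv _ _ hq (hiq.symm.trans hij)
  let L : (Fin (D.mult i) → K) →ₗ[ℂ] (Fin (D'.mult j) → K') :=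
    { toFun := fun y k => ⟨W (emb y) ⟨j, k⟩, mem_ker_sub_smul.2 (by
        have h1 := hW (emb y)
        rw [hembT, map_smul] at h1
        exact (congrArg (fun w : PiLp 2 fun q : (Σ i, Fin (D'.mult i)) => D'.space q.1 =>
          w ⟨j, k⟩) h1).symm)⟩
      map_add' := fun x y => by
        ext k
        simp
      map_smul' := fun c x => by
        ext k
        simp }
  have hL : Function.Injective L := by
    rw [← LinearMap.ker_eq_bot, LinearMap.ker_eq_bot']
    intro y hy
    have h0 : W (emb y) = 0 := by
      ext ⟨j', k⟩
      by_cases hj : j' = j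
      · subst hj
        exact congrArg Subtype.val (congrFun hy k)
      · exact hzero y ⟨j', k⟩ hj
    rw [map_eq_zero_iff W W.injective] at h0
    ext k
    have := hembk y k
    rw [h0] at this
    exact this.symm
  have hle := LinearMap.finrank_le_finrank_of_injective hL
  have hKK' : Module.finrank ℂ K = Module.finrank ℂ K' := hij.finrank_ker_eq z
  have hpos : 0 < Module.finrank ℂ K' := by
    rw [(D'.cowenDouglas j).finrank_ker z hz]; exact (D'.cowenDouglas j).pos
  rw [Module.finrank_pi_fintype, Module.finrank_pi_fintype] at hle
  simp only [Finset.sum_const, Finset.card_univ, Fintype.card_fin, smul_eq_mul, hKK'] at hle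
  exact Nat.le_of_mul_le_mul_right hle hpos

/-- The (IR) decompositions of unitarily equivalent operators agree up to a permutation. -/
theorem exists_equiv (D : IRDecomposition.{u, v} Ω n T) (D' : IRDecomposition.{u', v'} Ω n' T')
    (hΩ : Ω.Nonempty) (h : UnitarilyEquivalent T T') :
    ∃ π : Fin D.t ≃ Fin D'.t, ∀ i,
      UnitarilyEquivalent (D.summand i) (D'.summand (π i)) ∧ D.mult i = D'.mult (π i) := by
  choose f hf using D.exists_unitarilyEquivalent_summand D' hΩ h
  choose g hg using D'.exists_unitarilyEquivalent_summand D hΩ h.symm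
  -- The partner maps are mutually inverse because distinct summands within one decomposition are
  -- inequivalent.
  refine ⟨⟨f, g, fun i => ?_, fun j => ?_⟩, fun i => ⟨hf i, le_antisymm ?_ ?_⟩⟩
  · by_contra hne
    exact D.not_equiv _ _ hne ((hf i).trans (hg (f i))).symm
  · by_contra hne
    exact D'.not_equiv _ _ hne ((hg j).trans (hf (g j))).symm
  · exact D.mult_le D' hΩ h (hf i)
  · exact D'.mult_le D hΩ h.symm (hf i).symm

end IRDecomposition

theorem theorem4p2 {H : Type u} [NormedAddCommGroup H] [InnerProductSpace ℂ H] [CompleteSpace H]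
    (Ω : Set ℂ) (hΩ : IsOpen Ω) (hΩc : IsConnected Ω) (n : ℕ)
    (T : H →L[ℂ] H) (hT : IsCowenDouglas Ω n T) :
    Nonempty (IRDecomposition.{u, u} Ω n T) ∧
    ∀ (D : IRDecomposition.{u, v} Ω n T)
      (H' : Type u') [NormedAddCommGroup H'] [InnerProductSpace ℂ H'] [CompleteSpace H']
      (T' : H' →L[ℂ] H'), UnitarilyEquivalent T' T →
      ∀ D' : IRDecomposition.{u', v'} Ω n T',
        D.t = D'.t ∧
        ∃ π : Fin D.t ≃ Fin D'.t, ∀ i,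
          UnitarilyEquivalent (D.summand i) (D'.summand (π i)) ∧ D.mult i = D'.mult (π i) := by
  refine ⟨hT.nonempty_irDecomposition hΩc, fun D H' _ _ _ T' h D' => ?_⟩
  obtain ⟨π, hπ⟩ := D.exists_equiv D' hΩc.nonempty h.symm
  exact ⟨by simpa using Fintype.card_congr π, π, hπ⟩
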